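/- Let $c,n,m$ be nonnegative integers, $E,A\in\mathbb{R}^{c\times n}$, $B\in\mathbb{R}^{c\times m}$, and consider the DAE-LTI $$\frac{d(Ex)}{dt}=Ax+Bu .$$ An *interval* means one of $\mathbb{R}$, $[a,+\infty)$, $(-\infty,a]$, $[a,b]$ with $a\le b$ real. For an interval $I$, $AC(I)$ denotes the (vector-valued) functions that are absolutely continuous on every compact subinterval of $I$, and $L^1_{loc}(I)$ those integrable on every compact subinterval of $I$. Let $\mathcal{B}_I(E,A,B)$ be the set of all $(x,u)\in L^1_{loc}(I,\mathbb{R}^n)\times L^1_{loc}(I,\mathbb{R}^m)$ such that $Ex\in AC(I)$ and $Ex(t)=Ex(t_0)+\int_{t_0}^t(Ax(s)+Bu(s))\,ds$ for all $t_0\le t$ in $I$; a pair $(x,u)$ is identified with the $\mathbb{R}^{n+m}$-valued function $(x^T,u^T)^T$. An *ODE-LTI* $(\mathsf A,\mathsf B,\mathsf C,\mathsf D)$ with $r$ state variables, $k$ inputs and $d$ outputs is the system $\dot p=\mathsf Ap+\mathsf Bq$, $z=\mathsf Cp+\mathsf Dq$ with $\mathsf A\in\mathbb{R}^{r\times r}$,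 $\mathsf B\in\mathbb{R}^{r\times k}$, $\mathsf C\in\mathbb{R}^{d\times r}$, $\mathsf D\in\mathbb{R}^{d\times k}$, where $r,k$ are nonnegative integers (a matrix without columns has rank $0$, so has full column rank). It is a *realization* of a set $\mathcal{B}\subseteq L^1_{loc}(I,\mathbb{R}^d)$ if 1. for every $z\in\mathcal{B}$ there are $p\in AC(I,\mathbb{R}^r)$ and $q\in L^1_{loc}(I,\mathbb{R}^k)$ with $\dot p=\mathsf Ap+\mathsf Bq$ a.e. and $z=\mathsf Cp+\mathsf Dq$ a.e. on $I$; and 2. for all $p\in AC(I,\mathbb{R}^r)$ and $q\in L^1_{loc}(I,\mathbb{R}^k)$ with $\dot p=\mathsf Ap+\mathsf Bq$ a.e. on $I$ there is $z\in\mathcal{B}$ with $z=\mathsf Cp+\mathsf Dq$ a.e. on $I$. A realization of $\mathcal{B}\subseteq L^1_{loc}(\mathbb{R},\mathbb{R}^d)$ is *minimal* if no ODE-LTI (with any number of inputs) that is a realization of $\mathcal{B}$ has fewer state variables. An ODE-LTI $(\mathsf A,\mathsf B,\mathsf C,\mathsf D)$ with $r$ state variables, $k$ inputs and $n+m$ outputs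 is *associated with the DAE-LTI* if $r\le n$ and 1. either $\begin{bmatrix}\mathsf D\\ \mathsf B\end{bmatrix}=0$ and $k=1$, or $\operatorname{Rank}\mathsf D=k$; 2. $E\mathsf D_s=0$ and $\operatorname{Rank}(E\mathsf C_s)=r$, where $\mathsf C_s,\mathsf D_s$ consist of the first $n$ rows of $\mathsf C,\mathsf D$; 3. for every interval $I$, $(\mathsf A,\mathsf B,\mathsf C,\mathsf D)$ is a realization of $\mathcal{B}_I(E,A,B)$. **Corollary (Minimality).** (i) Every ODE-LTI associated with the DAE-LTI is a minimal realization of $\mathcal{B}_{\mathbb{R}}(E,A,B)$. (ii) Conversely, if $(\mathsf A,\mathsf B,\mathsf C,\mathsf D)$ is a minimal realization of $\mathcal{B}_{\mathbb{R}}(E,A,B)$ such that $\begin{bmatrix}\mathsf B\\ \mathsf D\end{bmatrix}$ either has full column rank or is zero with exactly one column, then $(\mathsf A,\mathsf B,\mathsf C,\mathsf D)$ is an ODE-LTI associated with the DAE-LTI. -/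

import Mathlib

open MeasureTheory Set

namespace DaeLti

/-- The admissible intervals: the whole line, closed half-lines, and compact intervals. -/
def IsTimeInterval (I : Set ℝ) : Prop :=
  I = univ ∨ (∃ a, I = Ici a) ∨ (∃ a, I = Iic a) ∨ ∃ a b, a ≤ b ∧ I = Icc a b

/-- `f ∈ AC(I)`: the function `f` is absolutely continuous on every compact subinterval of the
interval `I`. (Functions on `I` are represented by functions on `ℝ`, of which only the values on
`I` matter.) -/
def IsAC {d : Type*} [Fintype d] (I : Set ℝ) (f : ℝ → d → ℝ) : Prop :=
  ∀ a ∈ I, ∀ b ∈ I, AbsolutelyContinuousOnInterval f a b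

/-- `f ∈ L¹_loc(I)`. -/
def IsL1Loc {d : Type*} [Fintype d] (I : Set ℝ) (f : ℝ → d → ℝ) : Prop :=
  LocallyIntegrableOn f I volume

/-- `(x, u)` is a solution on `I` of the differential-algebraic system `d(Ex)/dt = Ax + Bu`. -/
structure IsSolution {c n m : ℕ} (I : Set ℝ)
    (E A : Matrix (Fin c) (Fin n) ℝ) (B : Matrix (Fin c) (Fin m) ℝ)
    (x : ℝ → Fin n → ℝ) (u : ℝ → Fin m → ℝ) : Prop where
  l1loc_x : IsL1Loc I x
  l1loc_u : IsL1Loc I u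
  ac : IsAC I (fun t => E.mulVec (x t))
  eqn : ∀ t₀ ∈ I, ∀ t ∈ I, t₀ ≤ t →
    E.mulVec (x t) = E.mulVec (x t₀) + ∫ s in t₀..t, (A.mulVec (x s) + B.mulVec (u s))

/-- The solution set `𝓑_I(E, A, B)`; a pair `(x, u)` is stored as the single function
`w = (xᵀ, uᵀ)ᵀ`, with coordinates indexed by `Fin n ⊕ Fin m`. -/
def behavior {c n m : ℕ} (I : Set ℝ)
    (E A : Matrix (Fin c) (Fin n) ℝ) (B : Matrix (Fin c) (Fin m) ℝ) :
    Set (ℝ → Fin n ⊕ Fin m → ℝ) :=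
  {w | IsSolution I E A B (fun t i => w t (Sum.inl i)) (fun t j => w t (Sum.inr j))}

/-- An ODE-LTI `ṗ = A p + B q`, `z = C p + D q` with `r` state variables, `s` inputs, and outputs
indexed by `o`. -/
structure OdeLti (r s : ℕ) (o : Type) where
  A : Matrix (Fin r) (Fin r) ℝ
  B : Matrix (Fin r) (Fin s) ℝ
  C : Matrix o (Fin r) ℝ
  D : Matrix o (Fin s) ℝ

namespace OdeLti

variable {r s : ℕ} {o : Type}

/-- `p ∈ AC(I)`, `q ∈ L¹_loc(I)` and `ṗ = A p + B q` almost everywhere on `I`. -/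
structure IsTrajectory (S : OdeLti r s o) (I : Set ℝ)
    (p : ℝ → Fin r → ℝ) (q : ℝ → Fin s → ℝ) : Prop where
  ac : IsAC I p
  l1loc : IsL1Loc I q
  deriv : ∀ᵐ t ∂(volume.restrict I),
    HasDerivWithinAt p (S.A.mulVec (p t) + S.B.mulVec (q t)) I t

/-- `z = C p + D q` almost everywhere on `I`. -/
def IsOutput (S : OdeLti r s o) (I : Set ℝ)
    (p : ℝ → Fin r → ℝ) (q : ℝ → Fin s → ℝ) (z : ℝ → o → ℝ) : Prop :=
  ∀ᵐ t ∂(volume.restrict I), z t = S.C.mulVec (p t) + S.D.mulVec (q t)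

/-- `S` is a realization of the set `𝓑` of functions on `I`. -/
structure IsRealization (S : OdeLti r s o) (I : Set ℝ) (𝓑 : Set (ℝ → o → ℝ)) : Prop where
  exists_trajectory : ∀ z ∈ 𝓑, ∃ p q, S.IsTrajectory I p q ∧ S.IsOutput I p q z
  exists_mem : ∀ p q, S.IsTrajectory I p q → ∃ z ∈ 𝓑, S.IsOutput I p q z

/-- `S` is a minimal realization of the set `𝓑` of functions on `ℝ`: it is a realization, and no
realization of `𝓑` (with any number of inputs) has fewer state variables. -/
structure IsMinimalRealization (S : OdeLti r s o) (𝓑 : Set (ℝ → o → ℝ)) : Prop where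
  isRealization : S.IsRealization univ 𝓑
  le : ∀ (r' s' : ℕ) (S' : OdeLti r' s' o), S'.IsRealization univ 𝓑 → r ≤ r'

/-- `S` is an ODE-LTI associated with the differential-algebraic system `d(Ex)/dt = Ax + Bu`.
Here `S.C.toRows₁` and `S.D.toRows₁` consist of the first `n` rows of `S.C` and `S.D`. -/
structure IsAssociated {c n m : ℕ} (S : OdeLti r s (Fin n ⊕ Fin m))
    (E A : Matrix (Fin c) (Fin n) ℝ) (B : Matrix (Fin c) (Fin m) ℝ) : Prop where
  dim_le : r ≤ n
  zero_or_rank : (Matrix.fromRows S.D S.B = 0 ∧ s = 1) ∨ S.D.rank = s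
  mul_D : E * S.D.toRows₁ = 0
  rank_mul_C : (E * S.C.toRows₁).rank = r
  isRealization : ∀ I : Set ℝ, IsTimeInterval I → S.IsRealization I (behavior I E A B)

end OdeLti

end DaeLti

namespace DaeLti

open scoped Matrix NNReal Topology

/-! ### Absolute continuity and local integrability on intervals -/

section Regularity

variable {d e : Type*} [Fintype d] [Fintype e] {I : Set ℝ}

/-! Put `w = (x, u)`, `F = [E 0]`, `G = [A B]`; the DAE becomes `d(Fw)/dt = Gw`. Let `V` be the
largest subspace with `G V ⊆ F V`. Every solution lies in `V` almost everywhere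
(`ae_mem_consistentSubspace`). Hence a system with `F D = 0`, `F C A = G C`, `F C B = G D`, `F C`
injective and `V ⊆ range [C D]` realizes the behavior on every interval: the state is read off from
`Fw` (`isRealization_of_algebraic`).

Conversely, step and constant inputs force the three identities on any realization over `ℝ`, and
`range [C D]` depends only on the behavior. Since `F D = 0`, the column space of `F C` is `F (range
[C D])`, so `rank (F C)` is an invariant of the behavior and bounds the number of states from below.
A canonical realization built on `F V` attains the bound. Thus a realization is minimal exactly when
`F C` is injective, which gives (i) and, with the algebraic criterion, (ii). -/

theorem lipschitzWith_mulVec (M : Matrix e d ℝ) :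
    ∃ K : ℝ≥0, LipschitzWith K fun v : d → ℝ => M *ᵥ v :=
  ⟨_, (LinearMap.toContinuousLinearMap M.mulVecLin).lipschitz⟩

omit [Fintype e] in
theorem continuous_mulVec (M : Matrix e d ℝ) : Continuous fun v : d → ℝ => M *ᵥ v :=
  (LinearMap.toContinuousLinearMap M.mulVecLin).continuous

theorem _root_.HasDerivAt.mulVec {f : ℝ → d → ℝ} {f' : d → ℝ} {t : ℝ} (hf : HasDerivAt f f' t)
    (M : Matrix e d ℝ) : HasDerivAt (fun t => M *ᵥ f t) (M *ᵥ f') t :=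
  (LinearMap.toContinuousLinearMap M.mulVecLin).hasFDerivAt.comp_hasDerivAt t hf

theorem _root_.HasDerivWithinAt.mulVec {f : ℝ → d → ℝ} {f' : d → ℝ} {t : ℝ}
    (hf : HasDerivWithinAt f f' I t) (M : Matrix e d ℝ) :
    HasDerivWithinAt (fun t => M *ᵥ f t) (M *ᵥ f') I t :=
  (LinearMap.toContinuousLinearMap M.mulVecLin).hasFDerivAt.comp_hasDerivWithinAt t hf

/-- A Lipschitz function of an absolutely continuous function is absolutely continuous. -/
theorem _root_.LipschitzWith.comp_absolutelyContinuousOnInterval {X Y : Type*}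
    [PseudoMetricSpace X] [PseudoMetricSpace Y] {K : ℝ≥0} {g : X → Y} (hg : LipschitzWith K g)
    {f : ℝ → X} {a b : ℝ} (hf : AbsolutelyContinuousOnInterval f a b) :
    AbsolutelyContinuousOnInterval (fun t => g (f t)) a b := by
  refine squeeze_zero (fun t => Finset.sum_nonneg fun i _ => dist_nonneg) (fun t => ?_)
    (by simpa using Filter.Tendsto.const_mul (K : ℝ) hf)
  rw [Finset.mul_sum]
  exact Finset.sum_le_sum fun i _ => hg.dist_le_mul _ _

theorem IsAC.mulVec {f : ℝ → d → ℝ} (hf : IsAC I f) (M : Matrix e d ℝ) :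
    IsAC I fun t => M *ᵥ f t := fun a ha b hb =>
  (lipschitzWith_mulVec M).choose_spec.comp_absolutelyContinuousOnInterval (hf a ha b hb)

theorem IsAC.continuousOn {f : ℝ → d → ℝ} (hf : IsAC I f) : ContinuousOn f I := by
  intro t ht
  -- `[a, b]` is to be a neighbourhood of `t` within `I`; where `t` is an endpoint of `I`, the point
  -- `t` itself serves.
  obtain ⟨a, ha, hat, ha'⟩ : ∃ a ∈ I, a ≤ t ∧ ∀ᶠ s in 𝓝[I] t, a ≤ s := by
    by_cases h : ∃ a ∈ I, a < t
    · obtain ⟨a, ha, hat⟩ := h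
      exact ⟨a, ha, hat.le, nhdsWithin_le_nhds (Ici_mem_nhds hat)⟩
    · push Not at h
      exact ⟨t, ht, le_rfl, Filter.eventually_of_mem self_mem_nhdsWithin fun s hs => h s hs⟩
  obtain ⟨b, hb, hbt, hb'⟩ : ∃ b ∈ I, t ≤ b ∧ ∀ᶠ s in 𝓝[I] t, s ≤ b := by
    by_cases h : ∃ b ∈ I, t < b
    · obtain ⟨b, hb, hbt⟩ := h
      exact ⟨b, hb, hbt.le, nhdsWithin_le_nhds (Iic_mem_nhds hbt)⟩
    · push Not at h
      exact ⟨t, ht, le_rfl, Filter.eventually_of_mem self_mem_nhdsWithin fun s hs => h s hs⟩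
  have hc := (hf a ha b hb).continuousOn
  rw [uIcc_of_le (hat.trans hbt)] at hc
  exact (hc t ⟨hat, hbt⟩).mono_of_mem_nhdsWithin (ha'.and hb')

theorem IsAC.of_contDiff {f : ℝ → d → ℝ} (hf : ContDiff ℝ 1 f) : IsAC I f :=
  fun _ _ _ _ => hf.contDiffOn.absolutelyContinuousOnInterval

theorem IsL1Loc.mulVec {f : ℝ → d → ℝ} (hf : IsL1Loc I f) (M : Matrix e d ℝ) :
    IsL1Loc I fun t => M *ᵥ f t := fun t ht =>
  let ⟨s, hs, hfs⟩ := hf t ht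
  ⟨s, hs, (LinearMap.toContinuousLinearMap M.mulVecLin).integrable_comp hfs⟩

theorem IsL1Loc.add {f g : ℝ → d → ℝ} (hf : IsL1Loc I f) (hg : IsL1Loc I g) :
    IsL1Loc I fun t => f t + g t := LocallyIntegrableOn.add hf hg

theorem IsL1Loc.sub {f g : ℝ → d → ℝ} (hf : IsL1Loc I f) (hg : IsL1Loc I g) :
    IsL1Loc I fun t => f t - g t := LocallyIntegrableOn.sub hf hg

theorem IsAC.isL1Loc {f : ℝ → d → ℝ} (hf : IsAC I f) (hI : I.OrdConnected) : IsL1Loc I f :=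
  hf.continuousOn.locallyIntegrableOn hI.measurableSet

theorem IsL1Loc.intervalIntegrable {f : ℝ → d → ℝ} (hf : IsL1Loc I f) (hI : I.OrdConnected)
    {a b : ℝ} (ha : a ∈ I) (hb : b ∈ I) : IntervalIntegrable f volume a b :=
  intervalIntegrable_iff.2 <|
    (hf.integrableOn_compact_subset (hI.uIcc_subset ha hb) isCompact_uIcc).mono_set uIoc_subset_uIcc

/-- The fundamental theorem of calculus for absolutely continuous functions. -/
theorem IsAC.eq_add_integral {f g : ℝ → d → ℝ} (hI : I.OrdConnected) (hf : IsAC I f)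
    (hg : IsL1Loc I g) (h : ∀ᵐ t ∂(volume.restrict I), HasDerivWithinAt f (g t) I t)
    {t₀ t : ℝ} (ht₀ : t₀ ∈ I) (ht : t ∈ I) (hle : t₀ ≤ t) :
    f t = f t₀ + ∫ s in t₀..t, g s := by
  rw [ae_restrict_iff' hI.measurableSet] at h
  funext i
  have hi : AbsolutelyContinuousOnInterval (fun s => f s i) t₀ t := by
    have hL : LipschitzWith 1 fun v : d → ℝ => v i := LipschitzWith.eval i
    exact hL.comp_absolutelyContinuousOnInterval (hf t₀ ht₀ t ht)
  have h1 : ∫ s in t₀..t, deriv (fun s => f s i) s = ∫ s in t₀..t, g s i := by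
    refine intervalIntegral.integral_congr_ae ?_
    -- Discarding the endpoint `t` makes `I` a neighbourhood of `s`, so the derivative within `I` is
    -- two-sided.
    filter_upwards [h, compl_mem_ae_iff.2 (measure_singleton t)] with s hs hst hmem
    rw [uIoc_of_le hle] at hmem
    have hst' : s < t := lt_of_le_of_ne hmem.2 hst
    have hnhds : I ∈ 𝓝 s :=
      Filter.mem_of_superset (Icc_mem_nhds hmem.1 hst') (hI.out ht₀ ht)
    exact (hasDerivAt_pi.1 ((hs (mem_of_mem_nhds hnhds)).hasDerivAt hnhds) i).deriv
  have h2 : ∫ s in t₀..t, g s i = (∫ s in t₀..t, g s) i :=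
    (ContinuousLinearMap.proj (R := ℝ) (φ := fun _ : d => ℝ) i).intervalIntegral_comp_comm
      (hg.intervalIntegrable hI ht₀ ht)
  rw [Pi.add_apply, ← h2, ← h1, hi.integral_deriv_eq_sub]
  ring

/-- An indefinite integral is differentiable almost everywhere, at interior points of `I`. -/
theorem ae_hasDerivAt_of_eq_add_integral {f g : ℝ → d → ℝ} (hI : I.OrdConnected)
    (hg : IsL1Loc I g)
    (h : ∀ t₀ ∈ I, ∀ t ∈ I, t₀ ≤ t → f t = f t₀ + ∫ s in t₀..t, g s) :
    ∀ᵐ t ∂(volume.restrict I), I ∈ 𝓝 t ∧ HasDerivAt f (g t) t := by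
  rw [ae_restrict_iff' hI.measurableSet]
  refine ae_of_mem_of_ae_of_mem_inter_Ioo fun a b ha hb hab => ?_
  filter_upwards [(hg.intervalIntegrable hI ha hb).ae_hasDerivAt_integral] with t ht htI
  have hIoo : Ioo a b ∈ 𝓝 t := Ioo_mem_nhds htI.2.1 htI.2.2
  rw [uIcc_of_le hab.le] at ht
  refine ⟨Filter.mem_of_superset hIoo (Ioo_subset_Icc_self.trans (hI.out ha hb)), ?_⟩
  refine ((ht (Ioo_subset_Icc_self htI.2) a (left_mem_Icc.2 hab.le)).const_add
    (f a)).congr_of_eventuallyEq ?_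
  filter_upwards [hIoo] with s hs
  exact h a ha s (hI.out ha hb (Ioo_subset_Icc_self hs)) hs.1.le

/-- An interval is null or contained in the closure of its interior. -/
theorem restrict_eq_zero_or_subset_closure_interior (hI : I.OrdConnected) :
    volume.restrict I = 0 ∨ I ⊆ closure (interior I) := by
  have hc : Convex ℝ I := hI.convex
  rcases (interior I).eq_empty_or_nonempty with h | h
  · left
    rw [Measure.restrict_eq_zero]
    -- With empty interior, `I` lies in its frontier, which is null for a convex set.
    refine measure_mono_null ?_ (hc.addHaar_frontier volume)
    rw [frontier, h, sdiff_empty]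
    exact subset_closure
  · right
    rw [hc.closure_interior_eq_closure_of_nonempty_interior h]
    exact subset_closure

/-- A closed condition that holds almost everywhere for a continuous function holds everywhere. -/
theorem forall_mem_of_ae_mem {X : Type*} [PseudoMetricSpace X] {K : Set X} (hK : IsClosed K)
    (hne : K.Nonempty) {f : ℝ → X} (hf : ContinuousOn f I) (hI : I ⊆ closure (interior I))
    (h : ∀ᵐ t ∂(volume.restrict I), f t ∈ K) : ∀ t ∈ I, f t ∈ K := by
  have h1 : (fun t => Metric.infDist (f t) K) =ᵐ[volume.restrict I] fun _ => 0 :=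
    h.mono fun t ht => (hK.mem_iff_infDist_zero hne).1 ht
  have h2 := Measure.eqOn_of_ae_eq h1
    ((Metric.continuous_infDist_pt K).comp_continuousOn hf) continuousOn_const hI
  exact fun t ht => (hK.mem_iff_infDist_zero hne).2 (h2 ht)

end Regularity

/-! ### Responses to constant and step inputs -/

section ConstantInput

variable {r k : ℕ}

/-- The system `ṗ = A p + B v` with a constant input `v` is solvable for each initial value. -/
theorem exists_hasDerivAt_constant_input (A : Matrix (Fin r) (Fin r) ℝ)
    (B : Matrix (Fin r) (Fin k) ℝ) (p₀ : Fin r → ℝ) (v : Fin k → ℝ) :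
    ∃ p : ℝ → Fin r → ℝ, p 0 = p₀ ∧ ContDiff ℝ 1 p ∧ ∀ t, HasDerivAt p (A *ᵥ p t + B *ᵥ v) t := by
  -- The input is adjoined to the state with zero derivative, so that the exponential of one matrix
  -- solves the system.
  let T : ((Fin r → ℝ) × (Fin k → ℝ)) →L[ℝ] ((Fin r → ℝ) × (Fin k → ℝ)) :=
    LinearMap.toContinuousLinearMap ((A.mulVecLin.coprod B.mulVecLin).prod 0)
  let y : ℝ → (Fin r → ℝ) × (Fin k → ℝ) := fun t => NormedSpace.exp (t • T) (p₀, v)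
  have hy : ∀ t, HasDerivAt y (T (y t)) t := fun t => by
    simpa [y] using (hasDerivAt_exp_smul_const' T t).clm_apply (hasDerivAt_const t (p₀, v))
  have hy0 : y 0 = (p₀, v) := by simp [y]
  have hT : ∀ z, T z = (A *ᵥ z.1 + B *ᵥ z.2, 0) := fun z => rfl
  have hsnd : ∀ t, (y t).2 = v := fun t => by
    have h : ∀ t, HasDerivAt (fun t => (y t).2) 0 t := fun t =>
      (ContinuousLinearMap.snd ℝ (Fin r → ℝ) (Fin k → ℝ)).hasFDerivAt.comp_hasDerivAt t (hy t)
    rw [is_const_of_deriv_eq_zero (fun t => (h t).differentiableAt) (fun t => (h t).deriv) t 0, hy0]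
  have hfst : ∀ t, HasDerivAt (fun t => (y t).1) (A *ᵥ (y t).1 + B *ᵥ v) t := fun t => by
    rw [← hsnd t]
    exact
      (ContinuousLinearMap.fst ℝ (Fin r → ℝ) (Fin k → ℝ)).hasFDerivAt.comp_hasDerivAt t (hy t)
  refine ⟨fun t => (y t).1, by simp [hy0], ?_, hfst⟩
  rw [contDiff_one_iff_deriv]
  refine ⟨fun t => (hfst t).differentiableAt, ?_⟩
  rw [show deriv (fun t => (y t).1) = fun t => A *ᵥ (y t).1 + B *ᵥ v from
    funext fun t => (hfst t).deriv]
  have hcont : Continuous fun t => (y t).1 :=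
    continuous_iff_continuousAt.2 fun t => (hfst t).continuousAt
  exact ((continuous_mulVec A).comp hcont).add continuous_const

variable {o : Type} (S : OdeLti r k o)

theorem OdeLti.exists_isTrajectory_constant_input (p₀ : Fin r → ℝ) (v : Fin k → ℝ) :
    ∃ p : ℝ → Fin r → ℝ, p 0 = p₀ ∧ Continuous p ∧ (∀ t, HasDerivAt p (S.A *ᵥ p t + S.B *ᵥ v) t) ∧
      S.IsTrajectory univ p fun _ => v := by
  obtain ⟨p, h0, hp, hd⟩ := exists_hasDerivAt_constant_input S.A S.B p₀ v
  exact ⟨p, h0, hp.continuous, hd, .of_contDiff hp,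
    continuous_const.locallyIntegrable.locallyIntegrableOn univ,
    .of_forall fun t => (hd t).hasDerivWithinAt⟩

/-- The response of a system at rest to a step input. -/
theorem OdeLti.exists_isTrajectory_step_input (v : Fin k → ℝ) :
    ∃ p : ℝ → Fin r → ℝ, S.IsTrajectory univ p (indicator (Ici 0) fun _ => v) := by
  obtain ⟨p, h0, hp, hd⟩ := exists_hasDerivAt_constant_input S.A S.B 0 v
  -- The state rests at `0` until time `0` and then follows the constant-input solution; the kink at
  -- `0` is a null set.
  refine ⟨fun t => p (max t 0), ?_, ?_, ?_⟩
  · intro a _ b _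
    obtain ⟨K, hK⟩ := (hp.contDiffOn (s := Icc 0 (max (max a b) 0))).exists_lipschitzOnWith
      one_ne_zero (convex_Icc _ _) isCompact_Icc
    have hmax : LipschitzWith 1 fun t : ℝ => max t 0 := LipschitzWith.id.max_const 0
    refine (hK.comp hmax.lipschitzOnWith fun t ht => ?_).absolutelyContinuousOnInterval
    exact ⟨le_max_right _ _, max_le_max_right 0 ht.2⟩
  · exact ((continuous_const.locallyIntegrable (μ := volume)).indicator
      measurableSet_Ici).locallyIntegrableOn univ
  · rw [Measure.restrict_univ]
    filter_upwards [compl_mem_ae_iff.2 (measure_singleton (0 : ℝ))] with t ht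
    rw [hasDerivWithinAt_univ]
    rcases lt_or_gt_of_ne (show t ≠ 0 from ht) with h | h
    · have h1 : max t 0 = 0 := max_eq_right h.le
      simp only [h1, h0, Matrix.mulVec_zero, indicator_of_notMem (show t ∉ Ici 0 from not_le.2 h),
        add_zero]
      refine (hasDerivAt_const t (0 : Fin r → ℝ)).congr_of_eventuallyEq ?_
      filter_upwards [Iio_mem_nhds h] with s hs
      rw [max_eq_right (le_of_lt hs), h0]
    · have h1 : max t 0 = t := max_eq_left h.le
      simp only [h1, indicator_of_mem (show t ∈ Ici 0 from le_of_lt h)]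
      refine (hd t).congr_of_eventuallyEq ?_
      filter_upwards [Ioi_mem_nhds h] with s hs
      rw [max_eq_left (le_of_lt hs)]

/-- Constant inputs produce solutions with continuous outputs, up to null sets. -/
theorem OdeLti.IsRealization.exists_constant_input {S : OdeLti r k o} {𝓑 : Set (ℝ → o → ℝ)} (h : S.IsRealization univ 𝓑)
    (p₀ : Fin r → ℝ) (v : Fin k → ℝ) :
    ∃ p : ℝ → Fin r → ℝ, p 0 = p₀ ∧ Continuous p ∧ (∀ t, HasDerivAt p (S.A *ᵥ p t + S.B *ᵥ v) t) ∧
      ∃ z ∈ 𝓑, ∀ᵐ t, z t = S.C *ᵥ p t + S.D *ᵥ v := by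
  obtain ⟨p, h0, hc, hd, hp⟩ := S.exists_isTrajectory_constant_input p₀ v
  obtain ⟨z, hz, hout⟩ := h.exists_mem _ _ hp
  rw [IsOutput, Measure.restrict_univ] at hout
  exact ⟨p, h0, hc, hd, z, hz, hout⟩

end ConstantInput

/-! ### Generalized inverses and rank -/

section LinearAlgebra

variable {K V W : Type*} [DivisionRing K] [AddCommGroup V] [Module K V] [AddCommGroup W]
  [Module K W]

/-- A linear section of `f` over its range extends to all of `W`. -/
theorem _root_.LinearMap.exists_generalized_inverse (f : V →ₗ[K] W) :
    ∃ g : W →ₗ[K] V, ∀ v, f (g (f v)) = f v := by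
  obtain ⟨h, hh⟩ := f.rangeRestrict.exists_rightInverse_of_surjective f.range_rangeRestrict
  obtain ⟨g, hg⟩ := LinearMap.exists_extend h
  refine ⟨g, fun v => ?_⟩
  have h1 : g (f v) = h (f.rangeRestrict v) := LinearMap.congr_fun hg (f.rangeRestrict v)
  have h2 := LinearMap.congr_fun hh (f.rangeRestrict v)
  rw [h1]
  exact congrArg Subtype.val h2

theorem _root_.Matrix.exists_generalized_inverse {a b : Type*} [Fintype a] [Fintype b]
    [DecidableEq a] [DecidableEq b] (M : Matrix a b ℝ) : ∃ N : Matrix b a ℝ, M * N * M = M := by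
  obtain ⟨g, hg⟩ := M.mulVecLin.exists_generalized_inverse
  refine ⟨LinearMap.toMatrix' g, Matrix.mulVec_injective (funext fun v => ?_)⟩
  simpa [← Matrix.mulVec_mulVec, LinearMap.toMatrix'_mulVec] using hg v

theorem _root_.Matrix.rank_eq_iff_mulVec_injective {a : Type*} [Fintype a] {k : ℕ}
    (M : Matrix a (Fin k) ℝ) : M.rank = k ↔ Function.Injective M.mulVec := by
  have h := LinearMap.finrank_range_add_finrank_ker M.mulVecLin
  rw [Module.finrank_fin_fun] at h
  change Module.finrank ℝ _ = k ↔ Function.Injective M.mulVecLin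
  rw [← LinearMap.ker_eq_bot, ← Submodule.finrank_eq_zero]
  omega

end LinearAlgebra

/-! ### The implicit system and its consistent subspace -/

section Pencil

variable {c r k r' k' : ℕ} {o : Type} [Fintype o] (F G : Matrix (Fin c) o ℝ)

/-- The solutions on `I` of the implicit system `d(Fw)/dt = G w`. -/
structure IsPencilSolution (I : Set ℝ) (w : ℝ → o → ℝ) : Prop where
  l1loc : IsL1Loc I w
  ac : IsAC I fun t => F *ᵥ w t
  eqn : ∀ t₀ ∈ I, ∀ t ∈ I, t₀ ≤ t → F *ᵥ w t = F *ᵥ w t₀ + ∫ s in t₀..t, G *ᵥ w s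

/-- The largest subspace `V` with `G V ⊆ F V`. -/
def consistentSubspace : Submodule ℝ (o → ℝ) :=
  sSup {V | V.map G.mulVecLin ≤ V.map F.mulVecLin}

theorem map_consistentSubspace_le :
    (consistentSubspace F G).map G.mulVecLin ≤ (consistentSubspace F G).map F.mulVecLin := by
  rw [Submodule.map_le_iff_le_comap]
  refine sSup_le fun V hV => Submodule.map_le_iff_le_comap.1 ?_
  exact (show V.map G.mulVecLin ≤ V.map F.mulVecLin from hV).trans (Submodule.map_mono (le_sSup hV))

theorem le_consistentSubspace {V : Submodule ℝ (o → ℝ)}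
    (hV : V.map G.mulVecLin ≤ V.map F.mulVecLin) : V ≤ consistentSubspace F G := le_sSup hV

variable {F G}

theorem IsPencilSolution.ae_hasDerivAt {I : Set ℝ} {w : ℝ → o → ℝ} (h : IsPencilSolution F G I w)
    (hI : I.OrdConnected) :
    ∀ᵐ t ∂(volume.restrict I), I ∈ 𝓝 t ∧ HasDerivAt (fun t => F *ᵥ w t) (G *ᵥ w t) t :=
  ae_hasDerivAt_of_eq_add_integral hI (h.l1loc.mulVec G) h.eqn

/-- Take a minimal subspace `V` containing `w t` almost everywhere. By continuity `F w` stays in the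
closed subspace `F V` everywhere, hence so do its difference quotients and their limit `G w`.
Minimality then gives `G V ⊆ F V`. -/
theorem IsPencilSolution.ae_mem_consistentSubspace {I : Set ℝ} {w : ℝ → o → ℝ}
    (h : IsPencilSolution F G I w) (hI : I.OrdConnected) :
    ∀ᵐ t ∂(volume.restrict I), w t ∈ consistentSubspace F G := by
  rcases restrict_eq_zero_or_subset_closure_interior hI with h0 | hcl
  · simp [h0]
  obtain ⟨V, hV, hmin⟩ := exists_minimal_of_wellFoundedLT
    (fun V : Submodule ℝ (o → ℝ) => ∀ᵐ t ∂(volume.restrict I), w t ∈ V) ⟨⊤, by simp⟩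
  have hcF : IsClosed (V.map F.mulVecLin : Set (Fin c → ℝ)) := Submodule.closed_of_finiteDimensional _
  have hF : ∀ t ∈ I, F *ᵥ w t ∈ V.map F.mulVecLin :=
    forall_mem_of_ae_mem hcF ⟨0, zero_mem _⟩ h.ac.continuousOn hcl
      (hV.mono fun t ht => Submodule.mem_map_of_mem (f := F.mulVecLin) ht)
  have hG : ∀ᵐ t ∂(volume.restrict I), w t ∈ V ⊓ (V.map F.mulVecLin).comap G.mulVecLin := by
    filter_upwards [hV, h.ae_hasDerivAt hI] with t ht ht'
    refine ⟨ht, hcF.mem_of_tendsto ht'.2.tendsto_slope ?_⟩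
    filter_upwards [nhdsWithin_le_nhds ht'.1] with s hs
    exact Submodule.smul_mem _ _ (Submodule.sub_mem _ (hF s hs) (hF t (mem_of_mem_nhds ht'.1)))
  have hle : V ≤ consistentSubspace F G :=
    le_consistentSubspace F G (Submodule.map_le_iff_le_comap.2
      ((hmin hG inf_le_left).trans inf_le_right))
  exact hV.mono fun t ht => hle ht

/-! ### Realizations of the implicit system -/

namespace OdeLti

variable {S : OdeLti r k o} {S' : OdeLti r' k' o}

/-- Since `F D = 0`, the output `z` has `F z = F C p`, which is absolutely continuous with
derivative `F C (A p + B q) = G z`. -/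
theorem isPencilSolution_of_isTrajectory {I : Set ℝ} (hI : I.OrdConnected)
    (hD : F * S.D = 0) (hA : F * S.C * S.A = G * S.C) (hB : F * S.C * S.B = G * S.D)
    {p : ℝ → Fin r → ℝ} {q : ℝ → Fin k → ℝ} (h : S.IsTrajectory I p q) :
    IsPencilSolution F G I fun t => S.C *ᵥ p t + S.D *ᵥ q t := by
  have hFz : ∀ t, F *ᵥ (S.C *ᵥ p t + S.D *ᵥ q t) = (F * S.C) *ᵥ p t := fun t => by
    rw [Matrix.mulVec_add, Matrix.mulVec_mulVec, Matrix.mulVec_mulVec, hD, Matrix.zero_mulVec,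
      add_zero]
  have hGz : ∀ t, G *ᵥ (S.C *ᵥ p t + S.D *ᵥ q t) =
      (F * S.C) *ᵥ (S.A *ᵥ p t + S.B *ᵥ q t) := fun t => by
    simp only [Matrix.mulVec_add, Matrix.mulVec_mulVec, hA, hB]
  have hz : IsL1Loc I fun t => S.C *ᵥ p t + S.D *ᵥ q t :=
    ((h.ac.isL1Loc hI).mulVec S.C).add (h.l1loc.mulVec S.D)
  refine ⟨hz, by simpa only [hFz] using h.ac.mulVec (F * S.C), fun t₀ ht₀ t ht hle => ?_⟩
  rw [hFz, hFz]
  refine (h.ac.mulVec (F * S.C)).eq_add_integral hI (hz.mulVec G) ?_ ht₀ ht hle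
  filter_upwards [h.deriv] with t ht
  rw [hGz]
  exact ht.mulVec _

/-- Algebraic conditions under which an explicit system realizes the implicit one. -/
theorem isRealization_of_algebraic {I : Set ℝ} (hI : I.OrdConnected)
    (hD : F * S.D = 0) (hA : F * S.C * S.A = G * S.C) (hB : F * S.C * S.B = G * S.D)
    (hinj : Function.Injective (F * S.C).mulVec)
    (hrange : ∀ w ∈ consistentSubspace F G, ∃ p v, w = S.C *ᵥ p + S.D *ᵥ v) :
    S.IsRealization I {w | IsPencilSolution F G I w} := by
  classical
  refine ⟨fun z hz => ?_, fun p q h => ⟨_, isPencilSolution_of_isTrajectory hI hD hA hB h,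
    .of_forall fun t => rfl⟩⟩
  -- State and input are recovered linearly, hence with the right regularity: `p = L F z` with `L` a
  -- left inverse of `F C`, and `q = M (z - C p)`.
  obtain ⟨L, hL⟩ := (F * S.C).exists_generalized_inverse
  obtain ⟨M, hM⟩ := S.D.exists_generalized_inverse
  have hL' : ∀ p, L *ᵥ ((F * S.C) *ᵥ p) = p := fun p => hinj <| by
    simp only [Matrix.mulVec_mulVec, ← Matrix.mul_assoc] at hL ⊢
    rw [hL]
  have hac : IsAC I fun t => L *ᵥ (F *ᵥ z t) := hz.ac.mulVec L
  have hout : ∀ᵐ t ∂(volume.restrict I), z t = S.C *ᵥ (L *ᵥ (F *ᵥ z t)) +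
      S.D *ᵥ (M *ᵥ (z t - S.C *ᵥ (L *ᵥ (F *ᵥ z t)))) := by
    filter_upwards [hz.ae_mem_consistentSubspace hI] with t ht
    obtain ⟨p, v, hpv⟩ := hrange _ ht
    have hFz : F *ᵥ z t = (F * S.C) *ᵥ p := by
      rw [hpv, Matrix.mulVec_add, Matrix.mulVec_mulVec, Matrix.mulVec_mulVec, hD,
        Matrix.zero_mulVec, add_zero]
    rw [hFz, hL']
    have hv : z t - S.C *ᵥ p = S.D *ᵥ v := by rw [hpv]; abel
    rw [hv, Matrix.mulVec_mulVec, Matrix.mulVec_mulVec, hM, hpv]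
  refine ⟨fun t => L *ᵥ (F *ᵥ z t), fun t => M *ᵥ (z t - S.C *ᵥ (L *ᵥ (F *ᵥ z t))),
    ⟨hac, (hz.l1loc.sub ((hac.isL1Loc hI).mulVec S.C)).mulVec M, ?_⟩, hout⟩
  filter_upwards [hout, hz.ae_hasDerivAt hI] with t ht ht'
  refine (ht'.2.mulVec L).hasDerivWithinAt.congr_deriv ?_
  set p := L *ᵥ (F *ᵥ z t)
  set q := M *ᵥ (z t - S.C *ᵥ p)
  have hGz : G *ᵥ (S.C *ᵥ p + S.D *ᵥ q) = (F * S.C) *ᵥ (S.A *ᵥ p + S.B *ᵥ q) := by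
    simp only [Matrix.mulVec_add, Matrix.mulVec_mulVec, hA, hB]
  rw [ht, hGz, hL']

/-- The output of a realization depends continuously on time after applying `F`, which a step
input violates unless `F D = 0`. -/
theorem IsRealization.mul_D_eq_zero (h : S.IsRealization univ {w | IsPencilSolution F G univ w}) :
    F * S.D = 0 := by
  refine Matrix.mulVec_injective (funext fun v => ?_)
  obtain ⟨p, hp⟩ := S.exists_isTrajectory_step_input v
  obtain ⟨z, hz, hout⟩ := h.exists_mem _ _ hp
  -- This continuous function equals almost everywhere `F D` applied to the step, so its value at
  -- `0` is both `F D v` (from the right) and `0` (from the left).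
  have hcont : Continuous fun t => F *ᵥ z t - (F * S.C) *ᵥ p t := by
    rw [← continuousOn_univ]
    exact hz.ac.continuousOn.sub (hp.ac.mulVec _).continuousOn
  have hval : ∀ᵐ t, F *ᵥ z t - (F * S.C) *ᵥ p t = (F * S.D) *ᵥ (Ici 0).indicator (fun _ => v) t := by
    rw [IsOutput, Measure.restrict_univ] at hout
    filter_upwards [hout] with t ht
    rw [ht, Matrix.mulVec_add, Matrix.mulVec_mulVec, Matrix.mulVec_mulVec, add_sub_cancel_left]
  have h1 := forall_mem_of_ae_mem (I := Ici (0 : ℝ)) (isClosed_singleton (x := (F * S.D) *ᵥ v))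
    ⟨_, rfl⟩ hcont.continuousOn (by simp) (by
      filter_upwards [ae_restrict_of_ae hval, ae_restrict_mem measurableSet_Ici] with t ht hmem
      rw [ht, indicator_of_mem hmem]; rfl) 0 self_mem_Ici
  have h2 := forall_mem_of_ae_mem (I := Iic (0 : ℝ)) (isClosed_singleton (x := (0 : Fin c → ℝ)))
    ⟨_, rfl⟩ hcont.continuousOn (by simp) (by
      rw [← restrict_Iio_eq_restrict_Iic]
      filter_upwards [ae_restrict_of_ae hval, ae_restrict_mem measurableSet_Iio] with t ht hmem
      rw [ht, indicator_of_notMem (show t ∉ Ici (0 : ℝ) from not_le.2 (mem_Iio.1 hmem)), Matrix.mulVec_zero]; rfl) 0 self_mem_Iic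
  rw [Matrix.zero_mulVec]
  exact (mem_singleton_iff.1 h1).symm.trans (mem_singleton_iff.1 h2)

/-- Under the constant input `v` from `p₀`, `F z = F C p` everywhere. Its derivative is `F C (A p +
B v)` and also, almost everywhere, `G z = G (C p + D v)`; both sides are continuous, so they agree
at time `0`. -/
theorem IsRealization.mul_C_mulVec (h : S.IsRealization univ {w | IsPencilSolution F G univ w})
    (p₀ : Fin r → ℝ) (v : Fin k → ℝ) :
    (F * S.C) *ᵥ (S.A *ᵥ p₀ + S.B *ᵥ v) = G *ᵥ (S.C *ᵥ p₀ + S.D *ᵥ v) := by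
  obtain ⟨p, rfl, hc, hd, z, hz, hout⟩ := h.exists_constant_input p₀ v
  have hFz : ∀ t, F *ᵥ z t = (F * S.C) *ᵥ p t := by
    have hcont : Continuous fun t => F *ᵥ z t := continuousOn_univ.1 hz.ac.continuousOn
    refine congrFun (Measure.eq_of_ae_eq (μ := volume) ?_ hcont ((continuous_mulVec _).comp hc))
    filter_upwards [hout] with t ht
    rw [ht, Matrix.mulVec_add, Matrix.mulVec_mulVec, Matrix.mulVec_mulVec, h.mul_D_eq_zero,
      Matrix.zero_mulVec, add_zero]
  have hae := hz.ae_hasDerivAt ordConnected_univ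
  rw [Measure.restrict_univ] at hae
  refine congrFun (Measure.eq_of_ae_eq (μ := volume)
    (f := fun t => (F * S.C) *ᵥ (S.A *ᵥ p t + S.B *ᵥ v))
    (g := fun t => G *ᵥ (S.C *ᵥ p t + S.D *ᵥ v)) ?_ ?_ ?_) 0
  · filter_upwards [hout, hae] with t ht ht'
    rw [← ht]
    have h1 : HasDerivAt (fun t => F *ᵥ z t) ((F * S.C) *ᵥ (S.A *ᵥ p t + S.B *ᵥ v)) t := by
      simpa only [hFz] using (hd t).mulVec (F * S.C)
    exact h1.unique ht'.2
  · exact (continuous_mulVec _).comp (((continuous_mulVec _).comp hc).add continuous_const)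
  · exact (continuous_mulVec _).comp (((continuous_mulVec _).comp hc).add continuous_const)

theorem IsRealization.mul_C_mul_A (h : S.IsRealization univ {w | IsPencilSolution F G univ w}) :
    F * S.C * S.A = G * S.C :=
  Matrix.mulVec_injective <| funext fun p => by
    simpa [Matrix.mulVec_mulVec] using h.mul_C_mulVec p 0

theorem IsRealization.mul_C_mul_B (h : S.IsRealization univ {w | IsPencilSolution F G univ w}) :
    F * S.C * S.B = G * S.D :=
  Matrix.mulVec_injective <| funext fun v => by
    simpa [Matrix.mulVec_mulVec] using h.mul_C_mulVec 0 v

/-- The attainable output values are the same for all realizations of a set of functions. -/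
theorem IsRealization.exists_output_eq {𝓑 : Set (ℝ → o → ℝ)} (h : S.IsRealization univ 𝓑)
    (h' : S'.IsRealization univ 𝓑) (p₀ : Fin r → ℝ) (v₀ : Fin k → ℝ) :
    ∃ p v, S.C *ᵥ p₀ + S.D *ᵥ v₀ = S'.C *ᵥ p + S'.D *ᵥ v := by
  obtain ⟨p, rfl, hc, -, z, hz, hout⟩ := h.exists_constant_input p₀ v₀
  obtain ⟨p', q', -, hout'⟩ := h'.exists_trajectory z hz
  rw [IsOutput, Measure.restrict_univ] at hout'
  -- `T` is the closed subspace of output values of `S'`; a continuous output lying in it almost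
  -- everywhere lies in it at time `0`.
  let T := LinearMap.range (S'.C.mulVecLin.coprod S'.D.mulVecLin)
  obtain ⟨⟨p₁, v₁⟩, h₁⟩ : S.C *ᵥ p 0 + S.D *ᵥ v₀ ∈ T := by
    refine forall_mem_of_ae_mem (I := univ) T.closed_of_finiteDimensional ⟨0, zero_mem _⟩
      (f := fun t => S.C *ᵥ p t + S.D *ᵥ v₀)
      (((continuous_mulVec _).comp hc).add continuous_const).continuousOn (by simp) ?_ 0 (mem_univ _)
    rw [Measure.restrict_univ]
    filter_upwards [hout, hout'] with t ht ht'
    exact ⟨(p' t, q' t), by rw [← ht, ht']; rfl⟩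
  exact ⟨p₁, v₁, h₁.symm⟩

/-- As `F D = 0`, the column space of `F C` is the image under `F` of the attainable outputs, which
all realizations share. By symmetry the ranks are equal. -/
theorem IsRealization.rank_mul_C_le (h : S.IsRealization univ {w | IsPencilSolution F G univ w})
    (h' : S'.IsRealization univ {w | IsPencilSolution F G univ w}) :
    (F * S.C).rank ≤ (F * S'.C).rank := by
  refine Submodule.finrank_mono ?_
  rintro _ ⟨p₀, rfl⟩
  obtain ⟨p, v, hpv⟩ := h.exists_output_eq h' p₀ 0
  refine ⟨p, ?_⟩
  have := congrArg F.mulVec hpv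
  simp only [Matrix.mulVec_zero, add_zero, Matrix.mulVec_add, Matrix.mulVec_mulVec,
    h'.mul_D_eq_zero, Matrix.zero_mulVec] at this
  exact this.symm

variable (F G)

/-- The canonical realization, whose state space is the image under `F` of the consistent
subspace. -/
theorem exists_canonical_realization :
    ∃ (r k : ℕ) (S : OdeLti r k o), S.IsRealization univ {w | IsPencilSolution F G univ w} ∧
      (F * S.C).rank = r ∧
      ∀ w ∈ consistentSubspace F G, ∃ p v, w = S.C *ᵥ p + S.D *ᵥ v := by
  classical
  set V := consistentSubspace F G
  let X := V.map F.mulVecLin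
  let K := V ⊓ LinearMap.ker F.mulVecLin
  -- `C` will be a linear section of `F` from `X = F V` into `V`, and `D` a basis of `V ∩ ker F`.
  obtain ⟨σ, hσ⟩ := (F.mulVecLin.submoduleMap V).exists_rightInverse_of_surjective
    (LinearMap.range_eq_top.2 (F.mulVecLin.submoduleMap_surjective V))
  let e : (Fin (Module.finrank ℝ X) → ℝ) ≃ₗ[ℝ] X := (Module.finBasis ℝ X).equivFun.symm
  let b : (Fin (Module.finrank ℝ K) → ℝ) ≃ₗ[ℝ] K := (Module.finBasis ℝ K).equivFun.symm
  let C := LinearMap.toMatrix' (V.subtype ∘ₗ σ ∘ₗ e.toLinearMap)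
  let D := LinearMap.toMatrix' (K.subtype ∘ₗ b.toLinearMap)
  have hC : ∀ p, C *ᵥ p = σ (e p) := fun p => LinearMap.toMatrix'_mulVec _ _
  have hD : ∀ v, D *ᵥ v = b v := fun v => LinearMap.toMatrix'_mulVec _ _
  have hFC : ∀ p, (F * C) *ᵥ p = e p := fun p => by
    rw [← Matrix.mulVec_mulVec, hC]
    exact congrArg Subtype.val (LinearMap.congr_fun hσ (e p))
  have hFD : F * D = 0 := Matrix.mulVec_injective <| funext fun v => by
    rw [← Matrix.mulVec_mulVec, hD, Matrix.zero_mulVec]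
    exact (b v).2.2
  have hinj : Function.Injective (F * C).mulVec := fun p p' h => by
    rw [hFC, hFC] at h
    exact e.injective (Subtype.ext h)
  obtain ⟨L, hL⟩ := (F * C).exists_generalized_inverse
  -- `F C L` fixes `X`, the range of `F C`, and `G V ⊆ X`; so `A = L G C` and `B = L G D` solve the
  -- two identities.
  have hG : ∀ w ∈ V, (F * C * L) *ᵥ (G *ᵥ w) = G *ᵥ w := fun w hw => by
    have hX : G *ᵥ w ∈ X :=
      map_consistentSubspace_le F G (Submodule.mem_map_of_mem (f := G.mulVecLin) hw)
    have h1 : G *ᵥ w = (F * C) *ᵥ (e.symm ⟨_, hX⟩) := by rw [hFC, e.apply_symm_apply]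
    rw [h1, Matrix.mulVec_mulVec, hL]
  have hrange : ∀ w ∈ V, ∃ p v, w = C *ᵥ p + D *ᵥ v := fun w hw => by
    let p := e.symm ⟨F *ᵥ w, Submodule.mem_map_of_mem (f := F.mulVecLin) hw⟩
    have hK : w - C *ᵥ p ∈ K := by
      refine ⟨Submodule.sub_mem _ hw (by rw [hC]; exact (σ _).2), ?_⟩
      change F *ᵥ (w - C *ᵥ p) = 0
      rw [Matrix.mulVec_sub, Matrix.mulVec_mulVec, hFC,
        e.apply_symm_apply, sub_self]
    refine ⟨p, b.symm ⟨_, hK⟩, ?_⟩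
    rw [hD, b.apply_symm_apply, add_sub_cancel]
  refine ⟨_, _, ⟨L * (G * C), L * (G * D), C, D⟩, isRealization_of_algebraic ordConnected_univ hFD
    ?_ ?_ hinj hrange, (Matrix.rank_eq_iff_mulVec_injective _).2 hinj, hrange⟩
  · refine Matrix.mulVec_injective <| funext fun p => ?_
    change (F * C * (L * (G * C))) *ᵥ p = (G * C) *ᵥ p
    rw [← Matrix.mul_assoc, ← Matrix.mulVec_mulVec, ← Matrix.mulVec_mulVec p G C]
    exact hG _ (by rw [hC]; exact (σ _).2)
  · refine Matrix.mulVec_injective <| funext fun v => ?_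
    change (F * C * (L * (G * D))) *ᵥ v = (G * D) *ᵥ v
    rw [← Matrix.mul_assoc, ← Matrix.mulVec_mulVec, ← Matrix.mulVec_mulVec v G D]
    exact hG _ (by rw [hD]; exact (b _).2.1)

end OdeLti

end Pencil

/-! ### Associated systems and minimality -/

section Main

variable {c n m r k : ℕ} (E A : Matrix (Fin c) (Fin n) ℝ) (B : Matrix (Fin c) (Fin m) ℝ)

theorem IsTimeInterval.ordConnected {I : Set ℝ} (hI : IsTimeInterval I) : I.OrdConnected := by
  rcases hI with rfl | ⟨a, rfl⟩ | ⟨a, rfl⟩ | ⟨a, b, -, rfl⟩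
  exacts [ordConnected_univ, ordConnected_Ici, ordConnected_Iic, ordConnected_Icc]

/-- The matrix `[E 0]` with `m` zero columns appended. -/
def appendZeroCols (m : ℕ) (E : Matrix (Fin c) (Fin n) ℝ) : Matrix (Fin c) (Fin n ⊕ Fin m) ℝ :=
  Matrix.fromCols E 0

theorem behavior_eq (I : Set ℝ) : behavior I E A B =
    {w | IsPencilSolution (appendZeroCols m E) (Matrix.fromCols A B) I w} := by
  have hE : ∀ v : Fin n ⊕ Fin m → ℝ, appendZeroCols m E *ᵥ v = E *ᵥ fun i => v (Sum.inl i) :=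
    fun v => by simp [appendZeroCols, Matrix.fromCols_mulVec, Function.comp_def]
  have hAB : ∀ v : Fin n ⊕ Fin m → ℝ, Matrix.fromCols A B *ᵥ v =
      (A *ᵥ fun i => v (Sum.inl i)) + B *ᵥ fun j => v (Sum.inr j) :=
    fun v => by simp [Matrix.fromCols_mulVec, Function.comp_def]
  ext w
  constructor
  · intro h
    refine ⟨?_, by simpa only [hE] using h.ac, by simpa only [hE, hAB] using h.eqn⟩
    convert (h.l1loc_x.mulVec (Matrix.fromRows (1 : Matrix (Fin n) (Fin n) ℝ) 0)).add
      (h.l1loc_u.mulVec (Matrix.fromRows 0 (1 : Matrix (Fin m) (Fin m) ℝ))) using 2 with t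
    ext i
    rcases i with i | i <;> simp [Matrix.fromRows_mulVec]
  · intro h
    refine ⟨?_, ?_, by simpa only [hE] using h.ac, by simpa only [hE, hAB] using h.eqn⟩
    · convert h.l1loc.mulVec (Matrix.fromCols (1 : Matrix (Fin n) (Fin n) ℝ) 0) using 2 with t
      simp [Matrix.fromCols_mulVec, Function.comp_def]
    · convert h.l1loc.mulVec (Matrix.fromCols 0 (1 : Matrix (Fin m) (Fin m) ℝ)) using 2 with t
      simp [Matrix.fromCols_mulVec, Function.comp_def]

theorem appendZeroCols_mul {a : Type*} (M : Matrix (Fin n ⊕ Fin m) a ℝ) :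
    appendZeroCols m E * M = E * M.toRows₁ := by
  conv_lhs => rw [← Matrix.fromRows_toRows M]
  rw [appendZeroCols, Matrix.fromCols_mul_fromRows, Matrix.zero_mul, add_zero]

variable {E A B} {S : OdeLti r k (Fin n ⊕ Fin m)}

/-- The rank of `F C` is `r`, and any other realization has the same rank with at least that many
states. -/
theorem OdeLti.IsAssociated.isMinimalRealization (h : S.IsAssociated E A B) :
    S.IsMinimalRealization (behavior univ E A B) := by
  have hS := h.isRealization univ (Or.inl rfl)
  refine ⟨hS, fun r' k' S' hS' => ?_⟩
  rw [behavior_eq] at hS hS'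
  have hle := hS.rank_mul_C_le hS'
  rw [appendZeroCols_mul, h.rank_mul_C] at hle
  exact hle.trans (Matrix.rank_le_width _)

theorem OdeLti.IsMinimalRealization.isAssociated
    (h : S.IsMinimalRealization (behavior univ E A B))
    (hBD : (Matrix.fromRows S.B S.D).rank = k ∨ (Matrix.fromRows S.B S.D = 0 ∧ k = 1)) :
    S.IsAssociated E A B := by
  have hS := h.isRealization
  have hmin := h.le
  rw [behavior_eq] at hS hmin
  obtain ⟨r₀, k₀, S₀, hS₀, hrank₀, hrange₀⟩ :=
    exists_canonical_realization (appendZeroCols m E) (Matrix.fromCols A B)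
  -- Comparison with the canonical system: `r ≤ r₀ = rank (F C₀) ≤ rank (F C) ≤ r`.
  have hrank : (appendZeroCols m E * S.C).rank = r :=
    le_antisymm (Matrix.rank_le_width _)
      ((hmin _ _ _ hS₀).trans (hrank₀.symm.le.trans (hS₀.rank_mul_C_le hS)))
  have hinj := (Matrix.rank_eq_iff_mulVec_injective _).1 hrank
  have hrange : ∀ w ∈ consistentSubspace (appendZeroCols m E) (Matrix.fromCols A B),
      ∃ p v, w = S.C *ᵥ p + S.D *ᵥ v := fun w hw => by
    obtain ⟨p, v, rfl⟩ := hrange₀ w hw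
    exact hS₀.exists_output_eq hS p v
  refine ⟨?_, ?_, ?_, ?_, fun I hI => ?_⟩
  · calc r = (E * S.C.toRows₁).rank := by rw [← appendZeroCols_mul, hrank]
      _ ≤ E.rank := Matrix.rank_mul_le_left _ _
      _ ≤ n := Matrix.rank_le_width _
  · rcases hBD with hBD | ⟨hBD, hk⟩
    · right
      rw [Matrix.rank_eq_iff_mulVec_injective] at hBD ⊢
      refine (injective_iff_map_eq_zero S.D.mulVecLin).2 fun v hv => ?_
      rw [Matrix.mulVecLin_apply] at hv
      -- If `D v = 0`, then `F C (B v) = G D v = 0`, and `F C` is injective; so `D` inherits full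
      -- column rank from `B` stacked on `D`.
      have hBv : S.B *ᵥ v = 0 := hinj <| by
        rw [Matrix.mulVec_zero, Matrix.mulVec_mulVec, hS.mul_C_mul_B, ← Matrix.mulVec_mulVec, hv,
          Matrix.mulVec_zero]
      refine hBD ?_
      rw [Matrix.fromRows_mulVec, hBv, hv, Matrix.mulVec_zero]
      exact Sum.elim_zero_zero
    · left
      have hB : S.B = 0 := congrArg Matrix.toRows₁ hBD
      have hD : S.D = 0 := congrArg Matrix.toRows₂ hBD
      exact ⟨by rw [hB, hD, Matrix.fromRows_zero], hk⟩
  · rw [← appendZeroCols_mul, hS.mul_D_eq_zero]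
  · rw [← appendZeroCols_mul, hrank]
  · rw [behavior_eq]
    exact isRealization_of_algebraic hI.ordConnected hS.mul_D_eq_zero hS.mul_C_mul_A
      hS.mul_C_mul_B hinj hrange

end Main

end DaeLti

theorem mainTheorem4 {c n m : ℕ}
    (E A : Matrix (Fin c) (Fin n) ℝ) (B : Matrix (Fin c) (Fin m) ℝ) :
    (∀ (r k : ℕ) (S : DaeLti.OdeLti r k (Fin n ⊕ Fin m)),
      S.IsAssociated E A B → S.IsMinimalRealization (DaeLti.behavior Set.univ E A B)) ∧
    (∀ (r k : ℕ) (S : DaeLti.OdeLti r k (Fin n ⊕ Fin m)),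
      S.IsMinimalRealization (DaeLti.behavior Set.univ E A B) →
      ((Matrix.fromRows S.B S.D).rank = k ∨ (Matrix.fromRows S.B S.D = 0 ∧ k = 1)) →
      S.IsAssociated E A B) :=
  ⟨fun _ _ _ h => h.isMinimalRealization, fun _ _ _ h hBD => h.isAssociated hBD⟩
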